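/- For an integer $n\ge 2$ let $G_n=\mathrm{Cay}(\mathrm{SL}(2,\mathbb{Z}/n);S_n)$ be the Cayley graph with generating set $S_n=\left\{\begin{pmatrix}1&1\\0&1\end{pmatrix},\begin{pmatrix}1&0\\1&1\end{pmatrix}\right\}$; its vertices are the elements of $\mathrm{SL}(2,\mathbb{Z}/n)$ and its edges join $g$ to $gs$ for $s\in S_n$. It is regarded as a simple graph, i.e. parallel edges (which occur only for $n=2$) are identified. For a simple graph $G$ write $N(x)$ for the set of neighbours of $x$ and $d_x=|N(x)|$. *Balanced Forman curvature.* For an edge $i\sim j$ put $\triangle=N(i)\cap N(j)$, and let $\square^i$ be the set of $k\in N(i)\setminus N(j)$, $k\ne j$, for which the set $W_i(k)=\{w\ne i: w\in N(k)\cap N(j),\ w\notin N(i)\}$ is non-empty; $\square^j$ and $W_j$ are defined with $i,j$ exchanged. Let $\gamma_{\max}$ be the maximum of the numbers $|W_i(k)|$ ($k\in\square^i$) and $|W_j(w)|$ ($w\in\square^j$). The balanced Forman curvature of $i\sim j$ is $0$ if $\min(d_i,d_j)=1$, and otherwise $$\frac{2}{d_i}+\frac{2}{d_j}-2+\frac{2|\triangle|}{\max(d_i,d_j)}+\frac{|\triangle|}{\min(d_i,d_j)}+\frac{|\square^i|+|\square^j|}{\gamma_{\max}\,\max(d_i,d_j)},$$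 where the last term is $0$ if $\square^i$ and $\square^j$ are empty. *Ollivier curvature.* For a vertex $x$ let $\mu_x$ be the one-step distribution of the lazy random walk: $\mu_x(x)=\tfrac12$, $\mu_x(y)=\tfrac1{2d_x}$ for $y\in N(x)$, and $\mu_x(y)=0$ otherwise. The Ollivier curvature of an edge $x\sim y$ is $1-W_1(\mu_x,\mu_y)$, where $W_1$ is the $L^1$ Wasserstein distance for the graph metric. **Proposition.** For every $n\ge 2$, $g\in\mathrm{SL}(2,\mathbb{Z}/n)$ and $s\in S_n$ the vertices $g$ and $gs$ are distinct (so $G_n$ has no loops). Every edge of $G_n$ has the same balanced Forman curvature $\mathrm{Ric}(n)$ and the same Ollivier curvature $\kappa(n)$, namely $$\mathrm{Ric}(n)=\begin{cases}0&n=2\\-1/4&n=3\\-1/2&n=4\\-1&n\ge5,\end{cases}\qquad \kappa(n)=\begin{cases}0&n=2\\-1/8&n=3\\-1/4&n=4\\-3/8&n=5\\-1/2&n\ge6.\end{cases}$$ -/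

import Mathlib

noncomputable section

/-- The generating set `{(1 1; 0 1), (1 0; 1 1)}` of `SL(2, ℤ/n)`. -/
def slGenerators (n : ℕ) : Set (Matrix.SpecialLinearGroup (Fin 2) (ZMod n)) :=
  {⟨!![1, 1; 0, 1], by simp [Matrix.det_fin_two]⟩,
   ⟨!![1, 0; 1, 1], by simp [Matrix.det_fin_two]⟩}

/-- The (simple graph underlying the) Cayley graph `G_n = Cay(SL(2, ℤ/n); S_n)`: distinct `u`, `v`
are adjacent iff `v = u * s` or `u = v * s` for some generator `s`. -/
def slCayley (n : ℕ) : SimpleGraph (Matrix.SpecialLinearGroup (Fin 2) (ZMod n)) :=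
  SimpleGraph.mulCayley (slGenerators n)

namespace GraphCurvature

variable {V : Type*}

/-- The degree of `x`. -/
def deg (G : SimpleGraph V) (x : V) : ℕ := (G.neighborSet x).ncard

/-- The third vertices of the triangles containing the edge `i ∼ j`. -/
def triangles (G : SimpleGraph V) (i j : V) : Set V := G.neighborSet i ∩ G.neighborSet j

/-- For a neighbour `k` of `i`: the vertices `w` such that `i, j, w, k` is a 4-cycle with
`i` and `w` not adjacent. -/
def squareTops (G : SimpleGraph V) (i j k : V) : Set V :=
  {w | G.Adj k w ∧ G.Adj j w ∧ ¬ G.Adj i w ∧ w ≠ i}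

/-- `□^i(i,j)`: the neighbours `k` of `i` forming a 4-cycle based at the edge `i ∼ j` without
diagonals inside. -/
def squares (G : SimpleGraph V) (i j : V) : Set V :=
  {k | G.Adj i k ∧ ¬ G.Adj j k ∧ k ≠ j ∧ (squareTops G i j k).Nonempty}

/-- `γ_max(i,j)`: the largest number of diagonal-free 4-cycles based at the edge `i ∼ j` that
traverse a common node other than `i`, `j` (it is `0` if there is no such 4-cycle). -/
def gammaMax (G : SimpleGraph V) (i j : V) : ℕ :=
  sSup ({m | ∃ k ∈ squares G i j, m = (squareTops G i j k).ncard} ∪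
    {m | ∃ w ∈ squares G j i, m = (squareTops G j i w).ncard})

open Classical in
/-- The balanced Forman curvature of an edge `i ∼ j` (Topping et al.). When there is no
diagonal-free 4-cycle based at the edge, the last summand is `0`, as it should be. -/
def balancedForman (G : SimpleGraph V) (i j : V) : ℝ :=
  if min (deg G i) (deg G j) = 1 then 0
  else
    2 / (deg G i : ℝ) + 2 / (deg G j : ℝ) - 2
      + 2 * ((triangles G i j).ncard : ℝ) / (max (deg G i) (deg G j) : ℕ)
      + ((triangles G i j).ncard : ℝ) / (min (deg G i) (deg G j) : ℕ)
      + (((squares G i j).ncard : ℝ) + ((squares G j i).ncard : ℝ))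
          / ((gammaMax G i j : ℝ) * (max (deg G i) (deg G j) : ℕ))

open Classical in
/-- The one-step distribution from `x` of the lazy random walk: stay at `x` with probability
`1/2`, otherwise move to a uniformly chosen neighbour. -/
def lazyStep (G : SimpleGraph V) (x y : V) : ℝ :=
  if y = x then 1 / 2 else if G.Adj x y then 1 / (2 * (deg G x : ℝ)) else 0

/-- `π` is a coupling of the finitely supported mass distributions `μ` and `ν`. -/
structure IsCoupling [Fintype V] (μ ν : V → ℝ) (π : V → V → ℝ) : Prop where
  nonneg : ∀ a b, 0 ≤ π a b
  fst : ∀ a, ∑ b, π a b = μ a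
  snd : ∀ b, ∑ a, π a b = ν b

/-- The `L¹` Wasserstein distance with respect to the graph distance. -/
def wasserstein [Fintype V] (G : SimpleGraph V) (μ ν : V → ℝ) : ℝ :=
  sInf {c | ∃ π : V → V → ℝ, IsCoupling μ ν π ∧ c = ∑ a, ∑ b, π a b * (G.dist a b : ℝ)}

/-- The Ollivier curvature along `x, y` for the lazy random walk on `G`. -/
def ollivier [Fintype V] (G : SimpleGraph V) (x y : V) : ℝ :=
  1 - wasserstein G (lazyStep G x) (lazyStep G y) / (G.dist x y : ℝ)

end GraphCurvature

end

/-! ### Ollivier curvature of an edge by Kantorovich duality -/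

namespace GraphCurvature
variable {V : Type*} {ι : Type*}

/-! Fix an edge from `x` to `y = x g`, with `g` a generator or the inverse of one. Both curvatures
depend only on distances among `x`, `y`, the other neighbours `a k` of `x` and the other neighbours
`b k` of `y`. Let n ≥ 3, so that there are three of each. The decisive short relation is g^n = 1: it
puts `a 1 = x g⁻¹` and `b 1 = x g²` at distance m = min(3, n - 3), while `a k` and `b k` are at
distance 3 for the two other `k`.

Moving `a k` to `b k` and the surplus at `x` to `y` costs 1/2 + (5 + m)/8, and explicit potentials
show that this is optimal, so κ = -(1 + m)/8 (`ollivier_eq`). The Forman curvature sees only whether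
`a 1 = b 1` (a triangle, n = 3), `a 1 ∼ b 1` (a square, n = 4), or neither. For n = 2 the graph is a
hexagon and the same argument runs with one `a` and one `b`.

Upper bounds on distances come from the path through `x` and `y` and from the g-cycle. For lower
bounds, a short path closes up to a short word in SL(2, ℤ) that is trivial modulo n, so n divides
its `level`. Only finitely many words matter, and for n ≥ 6 one computation serves all n because the
levels lie between 1 and 5. -/

theorem wasserstein_eq_of_dual [Fintype V] (G : SimpleGraph V) {μ ν : V → ℝ} {π : V → V → ℝ}
    {f g : V → ℝ} (hπ : IsCoupling μ ν π)
    (hle : ∀ a b, μ a ≠ 0 → ν b ≠ 0 → f a - g b ≤ (G.dist a b : ℝ))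
    (heq : ∑ a, ∑ b, π a b * (G.dist a b : ℝ) = ∑ a, f a * μ a - ∑ b, g b * ν b) :
    wasserstein G μ ν = ∑ a, f a * μ a - ∑ b, g b * ν b := by
  refine IsLeast.csInf_eq ⟨⟨π, hπ, heq.symm⟩, ?_⟩
  rintro c ⟨ρ, hρ, rfl⟩
  have hdual : ∑ a, f a * μ a - ∑ b, g b * ν b = ∑ a, ∑ b, ρ a b * (f a - g b) := by
    simp only [mul_sub, Finset.sum_sub_distrib]
    congr 1
    · refine Finset.sum_congr rfl fun a _ => ?_
      rw [← Finset.sum_mul, hρ.fst, mul_comm]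
    · rw [Finset.sum_comm]
      refine Finset.sum_congr rfl fun b _ => ?_
      rw [← Finset.sum_mul, hρ.snd, mul_comm]
  rw [hdual]
  refine Finset.sum_le_sum fun a _ => Finset.sum_le_sum fun b _ => ?_
  -- Where `ρ` is positive both marginals are nonzero, so the bound on the potentials is needed only
  -- on the supports.
  rcases (hρ.nonneg a b).eq_or_lt with h | h
  · simp [← h]
  · refine mul_le_mul_of_nonneg_left (hle a b ?_ ?_) h.le
    · have := Finset.single_le_sum (fun b _ => hρ.nonneg a b) (Finset.mem_univ b)
      rw [hρ.fst] at this
      linarith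
    · have := Finset.single_le_sum (fun a _ => hρ.nonneg a b) (Finset.mem_univ a)
      rw [hρ.snd] at this
      linarith

/-- `a` enumerates without repetition the neighbours of `x` other than its neighbour `y`. -/
structure EnumeratesOthers (G : SimpleGraph V) (x y : V) (a : ι → V) : Prop where
  adj_iff : ∀ p, G.Adj x p ↔ p = y ∨ ∃ i, p = a i
  injective : Function.Injective a
  ne : ∀ i, a i ≠ y

namespace EnumeratesOthers
variable {G : SimpleGraph V} {x y : V} {a b : ι → V}

theorem adj (h : EnumeratesOthers G x y a) : G.Adj x y := (h.adj_iff y).2 (.inl rfl)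

theorem adj_apply (h : EnumeratesOthers G x y a) (i : ι) : G.Adj x (a i) :=
  (h.adj_iff _).2 (.inr ⟨i, rfl⟩)

theorem deg_eq [Fintype ι] (h : EnumeratesOthers G x y a) : deg G x = Fintype.card ι + 1 := by
  have : G.neighborSet x = insert y (Set.range a) := by
    ext p
    simp [h.adj_iff, eq_comm]
  rw [deg, this, Set.ncard_insert_of_notMem (by rintro ⟨i, hi⟩; exact h.ne i hi)
    (Set.finite_range a), ← Nat.card_coe_set_eq, Nat.card_range_of_injective h.injective,
    Nat.card_eq_fintype_card]

open Classical in
theorem lazyStep_eq [Fintype ι] (h : EnumeratesOthers G x y a) (p : V) :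
    lazyStep G x p = (if p = x then 1 / 2 else 0) +
      1 / (2 * ((Fintype.card ι : ℝ) + 1)) *
        ((if p = y then 1 else 0) + ∑ i, if p = a i then 1 else 0) := by
  rw [lazyStep, h.deg_eq]
  push_cast
  by_cases hx : p = x
  · subst hx
    simp [h.adj.ne, (h.adj_apply _).ne]
  · by_cases hy : p = y
    · subst hy
      simp [hx, h.adj, (h.ne _).symm]
    · by_cases hi : ∃ i, p = a i
      · obtain ⟨i, rfl⟩ := hi
        simp [hx, hy, h.adj_apply, h.injective.eq_iff]
      · have : ¬ G.Adj x p := by simp [h.adj_iff, hy, hi]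
        push Not at hi
        simp [hx, hy, this, hi]

theorem sum_mul_lazyStep [Fintype V] [Fintype ι] (h : EnumeratesOthers G x y a) (f : V → ℝ) :
    ∑ p, f p * lazyStep G x p =
      f x / 2 + 1 / (2 * ((Fintype.card ι : ℝ) + 1)) * (f y + ∑ i, f (a i)) := by
  classical
  simp only [h.lazyStep_eq, mul_add, Finset.sum_add_distrib, Finset.mul_sum]
  rw [Finset.sum_comm]
  simp [mul_comm, div_eq_mul_inv]

theorem of_lazyStep_ne_zero (h : EnumeratesOthers G x y a) {p : V} (hp : lazyStep G x p ≠ 0) :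
    p = x ∨ p = y ∨ ∃ i, p = a i := by
  rw [← h.adj_iff]
  by_contra! hc
  simp [lazyStep, hc] at hp

/-- Kantorovich duality along an edge: the potentials are `2` at `x` and `1` at `y` (on both
sides), and the coupling moves `a i` to `b i` and the surplus mass at `x` to `y`. -/
theorem ollivier_eq [Fintype V] [Fintype ι] (ha : EnumeratesOthers G x y a)
    (hb : EnumeratesOthers G y x b) (α β : ι → ℝ) (hα : ∀ i, α i ≤ 3) (hβ : ∀ i, 0 ≤ β i)
    (hay : ∀ i, α i - 1 ≤ G.dist (a i) y) (hxb : ∀ i, 2 - β i ≤ G.dist x (b i))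
    (hab : ∀ i j, α i - β j ≤ G.dist (a i) (b j))
    (hdiag : ∀ i, (G.dist (a i) (b i) : ℝ) = α i - β i) :
    ollivier G x y = 1 - (1 / 2 + 1 / (2 * ((Fintype.card ι : ℝ) + 1)) *
      (∑ i, (α i - β i) - 1)) := by
  classical
  have hxy := ha.adj
  set c : ℝ := 1 / (2 * ((Fintype.card ι : ℝ) + 1)) with hc
  have hc0 : 0 ≤ c := by positivity
  have hc1 : c ≤ 1 / 2 := by
    rw [hc]
    apply one_div_le_one_div_of_le <;> norm_num
  have hax : ∀ i, a i ≠ x := fun i => (ha.adj_apply i).ne'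
  have hby : ∀ i, b i ≠ y := fun i => (hb.adj_apply i).ne'
  -- The potentials `f` and `g` are built independently, so a vertex that is both some `a i` and
  -- some `b j` causes no conflict.
  obtain ⟨f, fx, fy, fa⟩ : ∃ f : V → ℝ, f x = 2 ∧ f y = 1 ∧ ∀ i, f (a i) = α i := by
    refine ⟨Function.extend a α fun p => if p = x then 2 else 1, ?_, ?_, fun i => ?_⟩
    · rw [Function.extend_apply' _ _ _ (by rintro ⟨i, hi⟩; exact hax i hi)]; simp
    · rw [Function.extend_apply' _ _ _ (by rintro ⟨i, hi⟩; exact ha.ne i hi)]; simp [hxy.ne']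
    · rw [ha.injective.extend_apply]
  obtain ⟨g, gx, gy, gb⟩ : ∃ g : V → ℝ, g x = 2 ∧ g y = 1 ∧ ∀ i, g (b i) = β i := by
    refine ⟨Function.extend b β fun p => if p = x then 2 else 1, ?_, ?_, fun i => ?_⟩
    · rw [Function.extend_apply' _ _ _ (by rintro ⟨i, hi⟩; exact hb.ne i hi)]; simp
    · rw [Function.extend_apply' _ _ _ (by rintro ⟨i, hi⟩; exact hby i hi)]; simp [hxy.ne']
    · rw [hb.injective.extend_apply]
  let δ : V → V → ℝ := fun u p => if p = u then 1 else 0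
  let π : V → V → ℝ := fun p q => (1 / 2 - c) * (δ x p * δ y q) +
    c * (δ x p * δ x q + δ y p * δ y q + ∑ i, δ (a i) p * δ (b i) q)
  have hδ : ∀ u p, 0 ≤ δ u p := fun u p => by simp only [δ]; split_ifs <;> norm_num
  have hsum : ∀ u, ∑ p, δ u p = 1 := fun u => by simp [δ]
  have hπ : IsCoupling (lazyStep G x) (lazyStep G y) π := by
    refine ⟨fun p q => ?_, fun p => ?_, fun q => ?_⟩
    · have h1 := mul_nonneg (sub_nonneg.2 hc1) (mul_nonneg (hδ x p) (hδ y q))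
      have h2 : 0 ≤ ∑ i, δ (a i) p * δ (b i) q :=
        Finset.sum_nonneg fun i _ => mul_nonneg (hδ _ _) (hδ _ _)
      have h3 := mul_nonneg (hδ x p) (hδ x q)
      have h4 := mul_nonneg (hδ y p) (hδ y q)
      have h5 := mul_nonneg hc0 (add_nonneg (add_nonneg h3 h4) h2)
      exact add_nonneg h1 h5
    · have hs : ∑ q, ∑ i, δ (a i) p * δ (b i) q = ∑ i, δ (a i) p := by
        rw [Finset.sum_comm]
        simp only [← Finset.mul_sum, hsum, mul_one]
      simp only [π, Finset.sum_add_distrib, ← Finset.mul_sum, hsum, hs, mul_one, ha.lazyStep_eq]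
      rw [← hc]
      simp only [δ]
      split_ifs <;> ring
    · have hs : ∑ p, ∑ i, δ (a i) p * δ (b i) q = ∑ i, δ (b i) q := by
        rw [Finset.sum_comm]
        simp only [← Finset.sum_mul, hsum, one_mul]
      simp only [π, Finset.sum_add_distrib, ← Finset.mul_sum, ← Finset.sum_mul, hsum, hs, one_mul,
        hb.lazyStep_eq]
      rw [← hc]
      simp only [δ]
      split_ifs <;> ring
  have hone : G.dist x y = 1 := SimpleGraph.dist_eq_one_iff_adj.2 hxy
  have hval : ∑ p, f p * lazyStep G x p - ∑ q, g q * lazyStep G y q =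
      1 / 2 + c * (∑ i, (α i - β i) - 1) := by
    rw [ha.sum_mul_lazyStep, hb.sum_mul_lazyStep, ← hc]
    simp only [fx, fy, fa, gx, gy, gb, Finset.sum_sub_distrib]
    ring
  have hδδ : ∀ u v, ∑ p, δ u p * ∑ q, δ v q * (G.dist p q : ℝ) = G.dist u v := fun u v => by
    simp [δ]
  have hcost : ∑ p, ∑ q, π p q * (G.dist p q : ℝ) = 1 / 2 + c * (∑ i, (α i - β i) - 1) := by
    have hs : ∑ p, ∑ q, (∑ i, δ (a i) p * δ (b i) q) * (G.dist p q : ℝ) =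
        ∑ i, (α i - β i) := by
      simp only [Finset.sum_mul]
      rw [Finset.sum_congr rfl fun p _ => Finset.sum_comm, Finset.sum_comm]
      exact Finset.sum_congr rfl fun i _ => by
        simp only [mul_assoc, ← Finset.mul_sum, hδδ, hdiag]
    simp only [π, add_mul, Finset.sum_add_distrib, mul_add, mul_assoc, ← Finset.mul_sum,
      hδδ, hs, hone, SimpleGraph.dist_self]
    push_cast
    ring
  rw [ollivier, wasserstein_eq_of_dual G hπ (f := f) (g := g) _ (hcost.trans hval.symm), hval,
    hone]
  · simp
  intro p q hp hq
  have hxy1 : (G.dist x y : ℝ) = 1 := by simp [hone]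
  have hyx1 : (G.dist y x : ℝ) = 1 := by simp [SimpleGraph.dist_comm, hone]
  have hax1 : ∀ i, (G.dist (a i) x : ℝ) = 1 := fun i => by
    rw [SimpleGraph.dist_eq_one_iff_adj.2 (ha.adj_apply i).symm]; simp
  have hyb1 : ∀ i, (G.dist y (b i) : ℝ) = 1 := fun i => by
    rw [SimpleGraph.dist_eq_one_iff_adj.2 (hb.adj_apply i)]; simp
  rcases ha.of_lazyStep_ne_zero hp with rfl | rfl | ⟨i, rfl⟩ <;>
  rcases hb.of_lazyStep_ne_zero hq with rfl | rfl | ⟨j, rfl⟩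
  · rw [fx, gy, hxy1]; norm_num
  · simp [fx, gx]
  · rw [fx, gb]; exact hxb j
  · simp [fy, gy]
  · rw [fy, gx, hyx1]; norm_num
  · rw [fy, gb, hyb1]; linarith [hβ j]
  · rw [fa, gy]; exact hay i
  · rw [fa, gx, hax1]; linarith [hα i]
  · rw [fa, gb]; exact hab i j

/-! ### Balanced Forman curvature from adjacencies between the two neighbourhoods -/

theorem mem_triangles_iff (ha : EnumeratesOthers G x y a) (hb : EnumeratesOthers G y x b) {p : V} :
    p ∈ triangles G x y ↔ ∃ i j, p = a i ∧ a i = b j := by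
  simp only [triangles, Set.mem_inter_iff, SimpleGraph.mem_neighborSet]
  constructor
  · rintro ⟨h1, h2⟩
    obtain rfl | ⟨i, rfl⟩ := (ha.adj_iff p).1 h1
    · exact absurd h2 (G.loopless.irrefl _)
    obtain h | ⟨j, hj⟩ := (hb.adj_iff _).1 h2
    · exact absurd (h ▸ h1) (G.loopless.irrefl _)
    · exact ⟨i, j, rfl, hj⟩
  · rintro ⟨i, j, rfl, hj⟩
    exact ⟨ha.adj_apply i, hj ▸ hb.adj_apply j⟩

theorem mem_squareTops (hb : EnumeratesOthers G y x b) {k w : V} (hw : w ∈ squareTops G x y k) :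
    ∃ j, w = b j ∧ G.Adj k (b j) := by
  obtain ⟨h1, h2, -, h4⟩ := hw
  obtain rfl | ⟨j, rfl⟩ := (hb.adj_iff w).1 h2
  · exact absurd rfl h4
  · exact ⟨j, rfl, h1⟩

theorem mem_squares (ha : EnumeratesOthers G x y a) (hb : EnumeratesOthers G y x b) {k : V}
    (hk : k ∈ squares G x y) : ∃ i j, k = a i ∧ G.Adj (a i) (b j) := by
  obtain ⟨h1, -, h3, w, hw⟩ := hk
  obtain rfl | ⟨i, rfl⟩ := (ha.adj_iff k).1 h1
  · exact absurd rfl h3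
  · obtain ⟨j, -, hj⟩ := hb.mem_squareTops hw
    exact ⟨i, j, rfl, hj⟩

/-- A square based at the edge would need an edge from some `a i` to some `b j`. Triangles, where `a
i = b j`, remain possible; both degrees being equal, each contributes three times the inverse
degree. -/
theorem balancedForman_eq_of_not_adj [Fintype ι] [Nonempty ι] (ha : EnumeratesOthers G x y a)
    (hb : EnumeratesOthers G y x b) (hab : ∀ i j, ¬ G.Adj (a i) (b j)) :
    balancedForman G x y = (4 + 3 * ((triangles G x y).ncard : ℝ)) / (Fintype.card ι + 1) - 2 := by
  have h1 : squares G x y = ∅ := Set.eq_empty_of_forall_notMem fun k hk => by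
    obtain ⟨i, j, -, h⟩ := ha.mem_squares hb hk
    exact hab i j h
  have h2 : squares G y x = ∅ := Set.eq_empty_of_forall_notMem fun k hk => by
    obtain ⟨j, i, -, h⟩ := hb.mem_squares ha hk
    exact hab i j h.symm
  have hι : Fintype.card ι ≠ 0 := Fintype.card_ne_zero
  rw [balancedForman, ha.deg_eq, hb.deg_eq, min_self, max_self, if_neg (by omega), h1, h2]
  push_cast
  simp
  ring

theorem squares_eq_of_adj_iff (ha : EnumeratesOthers G x y a) (hb : EnumeratesOthers G y x b)
    (i₀ : ι) (hne : ∀ i j, a i ≠ b j) (hab : ∀ i j, G.Adj (a i) (b j) ↔ i = i₀ ∧ j = i₀) :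
    squares G x y = {a i₀} ∧ squareTops G x y (a i₀) = {b i₀} := by
  have htop : squareTops G x y (a i₀) = {b i₀} := by
    ext w
    constructor
    · intro hw
      obtain ⟨j, rfl, hj⟩ := hb.mem_squareTops hw
      rw [((hab _ _).1 hj).2, Set.mem_singleton_iff]
    · rintro rfl
      refine ⟨(hab _ _).2 ⟨rfl, rfl⟩, hb.adj_apply _, fun h => ?_, hb.ne _⟩
      obtain h | ⟨i, hi⟩ := (ha.adj_iff _).1 h
      · exact (hb.adj_apply i₀).ne' h
      · exact hne _ _ hi.symm
  refine ⟨?_, htop⟩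
  ext k
  constructor
  · intro hk
    obtain ⟨i, j, rfl, hj⟩ := ha.mem_squares hb hk
    rw [((hab _ _).1 hj).1, Set.mem_singleton_iff]
  · rintro rfl
    refine ⟨ha.adj_apply _, fun h => ?_, ha.ne _, by simp [htop]⟩
    obtain h | ⟨j, hj⟩ := (hb.adj_iff _).1 h
    · exact (ha.adj_apply i₀).ne' h
    · exact hne _ _ hj

/-- There is one square, seen once from each end, so `gammaMax` is 1 and the last term is twice the
inverse degree. -/
theorem balancedForman_eq_of_adj_iff [Fintype ι] (ha : EnumeratesOthers G x y a)
    (hb : EnumeratesOthers G y x b) (i₀ : ι) (hne : ∀ i j, a i ≠ b j)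
    (hab : ∀ i j, G.Adj (a i) (b j) ↔ i = i₀ ∧ j = i₀) :
    balancedForman G x y = 6 / (Fintype.card ι + 1) - 2 := by
  have htri : triangles G x y = ∅ := Set.eq_empty_of_forall_notMem fun p hp => by
    obtain ⟨i, j, -, h⟩ := (ha.mem_triangles_iff hb).1 hp
    exact hne i j h
  obtain ⟨h1, h2⟩ := ha.squares_eq_of_adj_iff hb i₀ hne hab
  obtain ⟨h3, h4⟩ := hb.squares_eq_of_adj_iff ha i₀ (fun i j => (hne j i).symm)
    fun i j => by rw [G.adj_comm, hab, and_comm]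
  have hγ : gammaMax G x y = 1 := by simp [gammaMax, h1, h2, h3, h4]
  have hι : Fintype.card ι ≠ 0 := (Fintype.card_pos_iff.2 ⟨i₀⟩).ne'
  rw [balancedForman, ha.deg_eq, hb.deg_eq, min_self, max_self, if_neg (by omega), h1, h3, hγ, htri]
  push_cast
  simp
  ring

end EnumeratesOthers
end GraphCurvature

/-! ### Words in SL(2, ℤ) and distances modulo n -/

open GraphCurvature

/-- The generators of `SL(2, ℤ)` and their inverses, ordered so that `i + 2` is inverse to `i`. -/
def gen (i : Fin 4) : Matrix.SpecialLinearGroup (Fin 2) ℤ :=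
  ![⟨!![1, 1; 0, 1], by simp [Matrix.det_fin_two]⟩,
    ⟨!![1, 0; 1, 1], by simp [Matrix.det_fin_two]⟩,
    ⟨!![1, -1; 0, 1], by simp [Matrix.det_fin_two]⟩,
    ⟨!![1, 0; -1, 1], by simp [Matrix.det_fin_two]⟩] i

/-- The generators other than `gen i` are `gen (i.turn k)`. -/
def Fin.turn (i : Fin 4) (k : Fin 3) : Fin 4 := i + 1 + k.castSucc

/-- The largest `n` modulo which `M` is congruent to the identity (`0` for the identity). -/
def level (M : Matrix.SpecialLinearGroup (Fin 2) ℤ) : ℕ :=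
  Nat.gcd (Nat.gcd (M.1 0 0 - 1).natAbs (M.1 0 1).natAbs)
    (Nat.gcd (M.1 1 0).natAbs (M.1 1 1 - 1).natAbs)

/-- The products of fewer than `k` generators. -/
def ball : ℕ → List (Matrix.SpecialLinearGroup (Fin 2) ℤ)
  | 0 => []
  | k + 1 => 1 :: (List.finRange 4).flatMap fun i => (ball k).map fun w => gen i * w

theorem gen_mul_gen_add_two : ∀ i : Fin 4, gen i * gen (i + 2) = 1 := by decide +kernel

/-- Turning commutes with inversion, so exchanging `x` and `y` preserves the index that pairs `a k`
with `b k`. -/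
theorem Fin.turn_add_two : ∀ (i : Fin 4) (k : Fin 3), i.turn k + 2 = (i + 2).turn k := by decide

theorem Fin.add_two_add_two : ∀ i : Fin 4, i + 2 + 2 = i := by decide

theorem Fin.eq_or_exists_eq_turn : ∀ i j : Fin 4, j = i ∨ ∃ k, j = i.turn k := by decide

theorem Fin.turn_injective : ∀ i : Fin 4, Function.Injective i.turn := by decide

theorem Fin.turn_ne : ∀ (i : Fin 4) (k : Fin 3), i.turn k ≠ i := by decide

theorem Fin.turn_one : ∀ i : Fin 4, i.turn 1 = i + 2 := by decide

theorem one_mem_ball (k : ℕ) : 1 ∈ ball (k + 1) := by simp [ball]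

theorem gen_mul_mem_ball {k : ℕ} {w : Matrix.SpecialLinearGroup (Fin 2) ℤ} (hw : w ∈ ball k)
    (i : Fin 4) : gen i * w ∈ ball (k + 1) := by
  simp only [ball, List.mem_cons, List.mem_flatMap, List.mem_map]
  exact .inr ⟨i, List.mem_finRange i, w, hw, rfl⟩

section reduction
variable (n : ℕ)

/-- Reduction modulo `n`. -/
abbrev red : Matrix.SpecialLinearGroup (Fin 2) ℤ →* Matrix.SpecialLinearGroup (Fin 2) (ZMod n) :=
  Matrix.SpecialLinearGroup.map (Int.castRingHom (ZMod n))

variable {n}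

theorem dvd_level_of_red_eq_one {M : Matrix.SpecialLinearGroup (Fin 2) ℤ} (h : red n M = 1) :
    n ∣ level M := by
  have key : ∀ i j, ((M.1 i j : ℤ) : ZMod n) = (1 : Matrix (Fin 2) (Fin 2) (ZMod n)) i j :=
    fun i j => congrFun (congrFun (congrArg Subtype.val h) i) j
  have hz : ∀ z : ℤ, (z : ZMod n) = 0 → n ∣ z.natAbs := fun z hz =>
    Int.natCast_dvd.1 ((ZMod.intCast_zmod_eq_zero_iff_dvd z n).1 hz)
  refine Nat.dvd_gcd (Nat.dvd_gcd ?_ ?_) (Nat.dvd_gcd ?_ ?_) <;> apply hz <;> simp [key]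

theorem red_gen_zero : red n (gen 0) = ⟨!![1, 1; 0, 1], by simp [Matrix.det_fin_two]⟩ := by
  ext i j
  rw [Matrix.SpecialLinearGroup.map_apply_coe]
  fin_cases i <;> fin_cases j <;> simp [gen]

theorem red_gen_one : red n (gen 1) = ⟨!![1, 0; 1, 1], by simp [Matrix.det_fin_two]⟩ := by
  ext i j
  rw [Matrix.SpecialLinearGroup.map_apply_coe]
  fin_cases i <;> fin_cases j <;> simp [gen]

theorem mem_slGenerators_iff {s : Matrix.SpecialLinearGroup (Fin 2) (ZMod n)} :
    s ∈ slGenerators n ↔ s = red n (gen 0) ∨ s = red n (gen 1) := by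
  rw [red_gen_zero, red_gen_one]; rfl

theorem red_gen_mul_red_gen_add_two (i : Fin 4) : red n (gen i) * red n (gen (i + 2)) = 1 := by
  rw [← map_mul, gen_mul_gen_add_two, map_one]

theorem eq_mul_red_gen {x y : Matrix.SpecialLinearGroup (Fin 2) (ZMod n)} (i : Fin 4) {j : Fin 4}
    (hj : j = i + 2) (h : y = x * red n (gen i)) : x = y * red n (gen j) := by
  rw [h, hj, mul_assoc, red_gen_mul_red_gen_add_two, mul_one]

theorem slCayley_adj_iff (hn : 2 ≤ n) {x y : Matrix.SpecialLinearGroup (Fin 2) (ZMod n)} :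
    (slCayley n).Adj x y ↔ ∃ i, y = x * red n (gen i) := by
  have hne : ∀ i, x ≠ x * red n (gen i) := fun i h => by
    have h1 := dvd_level_of_red_eq_one (mul_eq_left.1 h.symm)
    have h2 : ∀ i, level (gen i) = 1 := by decide +kernel
    rw [h2, Nat.dvd_one] at h1
    omega
  rw [slCayley, SimpleGraph.mulCayley_adj']
  simp only [mem_slGenerators_iff]
  constructor
  · rintro ⟨-, s, rfl | rfl, h | h⟩
    · exact ⟨0, h.symm⟩
    · exact ⟨2, eq_mul_red_gen 0 rfl h⟩
    · exact ⟨1, h.symm⟩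
    · exact ⟨3, eq_mul_red_gen 1 rfl h⟩
  · rintro ⟨i, rfl⟩
    refine ⟨hne i, ?_⟩
    obtain rfl | rfl | rfl | rfl : i = 0 ∨ i = 1 ∨ i = 2 ∨ i = 3 := by omega
    · exact ⟨_, .inl rfl, .inl rfl⟩
    · exact ⟨_, .inr rfl, .inl rfl⟩
    · exact ⟨_, .inl rfl, .inr (eq_mul_red_gen 2 rfl rfl)⟩
    · exact ⟨_, .inr rfl, .inr (eq_mul_red_gen 3 rfl rfl)⟩

theorem exists_mem_ball_of_walk (hn : 2 ≤ n) {x y : Matrix.SpecialLinearGroup (Fin 2) (ZMod n)}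
    (p : (slCayley n).Walk x y) : ∀ {k : ℕ}, p.length < k → ∃ w ∈ ball k, y = x * red n w := by
  induction p with
  | nil =>
    rintro (_ | k) hk
    · simp at hk
    · exact ⟨1, one_mem_ball k, by simp⟩
  | cons h p ih =>
    rintro (_ | k) hk
    · simp at hk
    · obtain ⟨i, rfl⟩ := (slCayley_adj_iff hn).1 h
      obtain ⟨w, hw, rfl⟩ := ih (by simpa using hk)
      exact ⟨gen i * w, gen_mul_mem_ball hw i, by rw [map_mul, mul_assoc]⟩

/-- If no product of fewer than `k` generators makes `M` trivial modulo `n`, then `M` moves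
vertices by a distance of at least `k`. -/
theorem le_dist_of_not_dvd_level (hn : 2 ≤ n) {x y : Matrix.SpecialLinearGroup (Fin 2) (ZMod n)}
    {M : Matrix.SpecialLinearGroup (Fin 2) ℤ} {k : ℕ} (hxy : y = x * red n M)
    (hM : ∀ w ∈ ball k, ¬ n ∣ level (M * w)) (hr : (slCayley n).Reachable x y) :
    k ≤ (slCayley n).dist x y := by
  by_contra! hk
  -- The walk is read from `y` back to `x`, so its word `w` closes up `M` without being inverted.
  -- Reachability matters because `dist` is 0 between different components.
  rw [SimpleGraph.dist_comm] at hk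
  obtain ⟨p, hp⟩ := hr.symm.exists_walk_length_eq_dist
  obtain ⟨w, hw, h⟩ := exists_mem_ball_of_walk hn p (hp.trans_lt hk)
  refine hM w hw (dvd_level_of_red_eq_one ?_)
  rw [hxy, mul_assoc, ← map_mul] at h
  exact mul_eq_left.1 h.symm

theorem exists_walk_pow (hn : 2 ≤ n) (x : Matrix.SpecialLinearGroup (Fin 2) (ZMod n)) (i : Fin 4)
    (k : ℕ) : ∃ p : (slCayley n).Walk x (x * red n (gen i) ^ k), p.length = k := by
  induction k generalizing x with
  | zero => exact ⟨SimpleGraph.Walk.nil.copy rfl (by simp), by simp⟩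
  | succ k ih =>
    obtain ⟨p, hp⟩ := ih (x * red n (gen i))
    exact ⟨(p.cons ((slCayley_adj_iff hn).2 ⟨i, rfl⟩)).copy rfl (by rw [pow_succ', mul_assoc]),
      by simp [hp]⟩

end reduction

/-! ### Potentials certified by finite computation -/

/-- Lower bounds, uniform in the generator `gen i`, for the distances in `slCayley n` from `1` and
the `gen (o i k)` to `gen i` and the `gen i * gen (o (i + 2) l)`. -/
def Separates (n : ℕ) {ι : Type*} (o : Fin 4 → ι → Fin 4) (α β : ι → ℕ) : Prop :=
  (∀ i k, ∀ w ∈ ball (α k - 1), ¬ n ∣ level (gen (o (i + 2) k) * gen i * w)) ∧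
  (∀ i l, ∀ w ∈ ball (2 - β l), ¬ n ∣ level (gen i * gen (o (i + 2) l) * w)) ∧
  ∀ i k l, ∀ w ∈ ball (α k - β l),
    ¬ n ∣ level (gen (o (i + 2) k) * gen i * gen (o (i + 2) l) * w)

instance (n : ℕ) {ι : Type*} [Fintype ι] (o : Fin 4 → ι → Fin 4) (α β : ι → ℕ) :
    Decidable (Separates n o α β) := inferInstanceAs (Decidable (_ ∧ _ ∧ _))

theorem separates_two : Separates 2 (fun i (_ : Unit) => i + 1) (fun _ => 3) (fun _ => 0) := by
  decide +kernel

theorem separates_three : Separates 3 Fin.turn ![3, 2, 3] ![0, 2, 0] := by decide +kernel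

/-- Since `a 1 = b 1`, the two potentials agree there, with value 1 or 2. The value 2 gives the
sharp bound from `a 1` to `b 0` and `b 2`, the value 1 that from `a 0` and `a 2` to `b 1`; the
Forman curvature needs both. -/
theorem separates_three' : Separates 3 Fin.turn ![3, 1, 3] ![0, 1, 0] := by decide +kernel

theorem separates_four : Separates 4 Fin.turn ![3, 2, 3] ![0, 1, 0] := by decide +kernel

theorem separates_five : Separates 5 Fin.turn ![3, 2, 3] ![0, 0, 0] := by decide +kernel

theorem separates_of_six_le {n : ℕ} (hn : 6 ≤ n) :
    Separates n Fin.turn ![3, 3, 3] ![0, 0, 0] := by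
  have key : ∀ {M}, level M ∈ Finset.Icc 1 5 → ¬ n ∣ level M := fun h hd => by
    rw [Finset.mem_Icc] at h
    have := Nat.le_of_dvd (by omega) hd
    omega
  refine ⟨fun i k w hw => key ?_, fun i k w hw => key ?_, fun i k l w hw => key ?_⟩
  · revert i k w; decide +kernel
  · revert i k w; decide +kernel
  · revert i k l w; decide +kernel

/-! ### The neighbourhood of an edge -/

section edge
variable {n : ℕ} {ι : Type*} {o : Fin 4 → ι → Fin 4}
  {x y : Matrix.SpecialLinearGroup (Fin 2) (ZMod n)} {i : Fin 4}

theorem red_gen_injective (hn : 3 ≤ n) : Function.Injective fun i => red n (gen i) := by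
  intro i j h
  by_contra hij
  have h1 : red n (gen i * gen (j + 2)) = 1 := by
    rw [map_mul]
    dsimp only at h
    rw [h, red_gen_mul_red_gen_add_two]
  have h2 : ∀ i j, i ≠ j → level (gen i * gen (j + 2)) ∈ Finset.Icc 1 2 := by decide +kernel
  have h3 := Finset.mem_Icc.1 (h2 i j hij)
  have := Nat.le_of_dvd (by omega) (dvd_level_of_red_eq_one h1)
  omega

theorem enumeratesOthers_turn (hn : 3 ≤ n) (h : y = x * red n (gen i)) :
    EnumeratesOthers (slCayley n) x y (fun k => x * red n (gen (i.turn k))) where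
  adj_iff p := by
    rw [slCayley_adj_iff (by omega), h]
    constructor
    · rintro ⟨j, rfl⟩
      obtain rfl | ⟨k, rfl⟩ := Fin.eq_or_exists_eq_turn i j
      · exact .inl rfl
      · exact .inr ⟨k, rfl⟩
    · rintro (rfl | ⟨k, rfl⟩) <;> exact ⟨_, rfl⟩
  injective k l hkl := i.turn_injective (red_gen_injective hn (mul_left_cancel hkl))
  ne k hk := i.turn_ne k (red_gen_injective hn (mul_left_cancel (hk.trans h)))

/-- Modulo 2 each generator is its own inverse, so the degree drops to 2. -/
theorem enumeratesOthers_two {x y : Matrix.SpecialLinearGroup (Fin 2) (ZMod 2)} {i : Fin 4}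
    (h : y = x * red 2 (gen i)) :
    EnumeratesOthers (slCayley 2) x y (fun _ : Unit => x * red 2 (gen (i + 1))) where
  adj_iff p := by
    have h2 : ∀ i, red 2 (gen (i + 2)) = red 2 (gen i) := by decide +kernel
    have hi : ∀ i j : Fin 4, j = i ∨ j = i + 2 ∨ j = i + 1 ∨ j = i + 1 + 2 := by decide
    rw [slCayley_adj_iff le_rfl, h]
    constructor
    · rintro ⟨j, rfl⟩
      obtain rfl | rfl | rfl | rfl := hi i j <;> simp [h2]
    · rintro (rfl | ⟨k, rfl⟩) <;> exact ⟨_, rfl⟩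
  injective _ _ _ := rfl
  ne k hk := by
    have h2 : ∀ i, red 2 (gen (i + 1)) ≠ red 2 (gen i) := by decide +kernel
    exact h2 i (mul_left_cancel (hk.trans h))

theorem le_dist_of_separates {α β : ι → ℕ} (hn : 2 ≤ n) (ho : ∀ i k, o i k + 2 = o (i + 2) k)
    (hs : Separates n o α β) (h : y = x * red n (gen i)) (k l : ι) :
    α k - 1 ≤ (slCayley n).dist (x * red n (gen (o i k))) y ∧
    2 - β l ≤ (slCayley n).dist x (y * red n (gen (o (i + 2) l))) ∧
    α k - β l ≤
      (slCayley n).dist (x * red n (gen (o i k))) (y * red n (gen (o (i + 2) l))) := by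
  have hadj : ∀ (z : Matrix.SpecialLinearGroup (Fin 2) (ZMod n)) j,
      (slCayley n).Reachable z (z * red n (gen j)) := fun z j =>
    ((slCayley_adj_iff hn).2 ⟨j, rfl⟩ : (slCayley n).Adj _ _).reachable
  have hxy : (slCayley n).Reachable x y := h ▸ hadj x i
  have hya : y = x * red n (gen (o i k)) * red n (gen (o (i + 2) k) * gen i) := by
    rw [map_mul, ← ho, mul_assoc, ← mul_assoc (red n _) (red n _), red_gen_mul_red_gen_add_two,
      one_mul, h]
  refine ⟨le_dist_of_not_dvd_level hn hya (hs.1 i k) ((hadj x _).symm.trans hxy),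
    le_dist_of_not_dvd_level hn ?_ (hs.2.1 i l) (hxy.trans (hadj y _)),
    le_dist_of_not_dvd_level hn ?_ (hs.2.2 i k l) (((hadj x _).symm.trans hxy).trans (hadj y _))⟩
  · rw [map_mul, ← mul_assoc, ← h]
  · rw [map_mul, ← mul_assoc, ← hya]

theorem dist_le_three (hn : 2 ≤ n) (h : y = x * red n (gen i)) (j l : Fin 4) :
    (slCayley n).dist (x * red n (gen j)) (y * red n (gen l)) ≤ 3 := by
  have hadj : ∀ (z : Matrix.SpecialLinearGroup (Fin 2) (ZMod n)) j,
      (slCayley n).Adj z (z * red n (gen j)) := fun z j => (slCayley_adj_iff hn).2 ⟨j, rfl⟩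
  exact SimpleGraph.dist_le
    (.cons (hadj x j).symm (.cons (h ▸ hadj x i) (.cons (hadj y l) .nil)))

/-- The path through `x` and `y` uses three steps of a closed walk of `k + 3` steps along powers of
`gen i`; the remaining `k` steps join the same endpoints. -/
theorem dist_le_of_red_pow_eq_one {k : ℕ} (hn : 2 ≤ n) (hk : red n (gen i) ^ (k + 3) = 1)
    (h : y = x * red n (gen i)) :
    (slCayley n).dist (x * red n (gen (i + 2))) (y * red n (gen i)) ≤ k := by
  obtain ⟨p, hp⟩ := exists_walk_pow hn (y * red n (gen i)) i k
  have : y * red n (gen i) * red n (gen i) ^ k = x * red n (gen (i + 2)) := by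
    have h1 : red n (gen (i + 2)) = red n (gen i) ^ (k + 2) := by
      rw [← one_mul (red n (gen (i + 2))), ← hk, pow_succ, mul_assoc, red_gen_mul_red_gen_add_two,
        mul_one]
    rw [h, h1]
    group
  rw [SimpleGraph.dist_comm, ← this]
  exact (SimpleGraph.dist_le p).trans hp.le

theorem ollivier_of_separates [Fintype ι] [NeZero n] {α β : ι → ℕ} (hn : 2 ≤ n)
    (ho : ∀ i k, o i k + 2 = o (i + 2) k) (hs : Separates n o α β) (h : y = x * red n (gen i))
    (ha : EnumeratesOthers (slCayley n) x y fun k => x * red n (gen (o i k)))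
    (hb : EnumeratesOthers (slCayley n) y x fun k => y * red n (gen (o (i + 2) k)))
    (hα : ∀ k, α k ≤ 3) (hβα : ∀ k, β k ≤ α k)
    (hdiag : ∀ k, (slCayley n).dist (x * red n (gen (o i k))) (y * red n (gen (o (i + 2) k))) ≤
      α k - β k) :
    ollivier (slCayley n) x y = 1 - (1 / 2 + 1 / (2 * ((Fintype.card ι : ℝ) + 1)) *
      (∑ k, ((α k : ℝ) - β k) - 1)) := by
  have hle := fun k l => le_dist_of_separates hn ho hs h k l
  -- Where `p < q`, truncated subtraction gives the bound 0, which still implies the real one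
  -- because distances are nonnegative.
  have hcast : ∀ {p q d : ℕ}, p - q ≤ d → (p : ℝ) - q ≤ d := fun hd => by
    rw [sub_le_iff_le_add]
    exact_mod_cast Nat.sub_le_iff_le_add.1 hd
  refine ha.ollivier_eq hb (fun k => α k) (fun k => β k) (fun k => by exact_mod_cast hα k)
    (fun k => by positivity) (fun k => by exact_mod_cast hcast (hle k k).1)
    (fun k => by exact_mod_cast hcast (hle k k).2.1) (fun k l => hcast (hle k l).2.2) fun k => ?_
  rw [← Nat.cast_sub (hβα k), le_antisymm (hdiag k) (hle k k).2.2]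

end edge

/-! ### The values for each n -/

theorem curvature_two {x y : Matrix.SpecialLinearGroup (Fin 2) (ZMod 2)} {i : Fin 4}
    (h : y = x * red 2 (gen i)) :
    balancedForman (slCayley 2) x y = 0 ∧ ollivier (slCayley 2) x y = 0 := by
  have ho : ∀ (i : Fin 4) (_ : Unit), i + 1 + 2 = i + 2 + 1 := by decide
  have ha := enumeratesOthers_two h
  have hb := enumeratesOthers_two (eq_mul_red_gen i rfl h)
  have hle := fun k l => (le_dist_of_separates le_rfl ho separates_two h k l).2.2
  constructor
  · have htri : triangles (slCayley 2) x y = ∅ := Set.eq_empty_of_forall_notMem fun p hp => by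
      obtain ⟨k, l, -, hkl⟩ := (ha.mem_triangles_iff hb).1 hp
      have := hle k l
      simp [hkl] at this
    rw [ha.balancedForman_eq_of_not_adj hb, htri]
    · norm_num
    · intro k l hkl
      have := hle k l
      simp [SimpleGraph.dist_eq_one_iff_adj.2 hkl] at this
  · rw [ollivier_of_separates le_rfl ho separates_two h ha hb (by simp) (by simp)
      fun k => dist_le_three le_rfl h _ _]
    norm_num

section turn
variable {n : ℕ} [NeZero n] {x y : Matrix.SpecialLinearGroup (Fin 2) (ZMod n)} {i : Fin 4}

theorem ollivier_of_separates_turn {u v : ℕ} (hn : 3 ≤ n)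
    (hs : Separates n Fin.turn ![3, u, 3] ![0, v, 0]) (h : y = x * red n (gen i)) (hu : u ≤ 3)
    (hvu : v ≤ u)
    (hd : (slCayley n).dist (x * red n (gen (i + 2))) (y * red n (gen i)) ≤ u - v) :
    ollivier (slCayley n) x y = -(1 + ((u : ℝ) - v)) / 8 := by
  have hn2 : 2 ≤ n := by omega
  rw [ollivier_of_separates hn2 Fin.turn_add_two hs h (enumeratesOthers_turn hn h)
    (enumeratesOthers_turn hn (eq_mul_red_gen i rfl h))]
  · simp [Fin.sum_univ_three]
    ring
  · intro k; fin_cases k <;> simp [hu]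
  · intro k; fin_cases k <;> simp [hvu]
  · intro k
    fin_cases k
    · exact dist_le_three hn2 h _ _
    · simpa [Fin.turn_one, Fin.add_two_add_two] using hd
    · exact dist_le_three hn2 h _ _

end turn

theorem curvature_three {x y : Matrix.SpecialLinearGroup (Fin 2) (ZMod 3)} {i : Fin 4}
    (h : y = x * red 3 (gen i)) :
    balancedForman (slCayley 3) x y = -1 / 4 ∧ ollivier (slCayley 3) x y = -1 / 8 := by
  have hpow : ∀ i, red 3 (gen i) ^ (0 + 3) = 1 := by decide +kernel
  have hd := dist_le_of_red_pow_eq_one (by norm_num) (hpow i) h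
  have ha := enumeratesOthers_turn le_rfl h
  have hb := enumeratesOthers_turn le_rfl (eq_mul_red_gen i rfl h)
  have hle := fun k l =>
    (le_dist_of_separates (by norm_num) Fin.turn_add_two separates_three h k l).2.2
  have hle' := fun k l =>
    (le_dist_of_separates (by norm_num) Fin.turn_add_two separates_three' h k l).2.2
  have hsq : x * red 3 (gen (i.turn 1)) = y * red 3 (gen ((i + 2).turn 1)) := by
    have h2 : ∀ i, red 3 (gen (i + 2)) = red 3 (gen i * gen i) := by decide +kernel
    rw [Fin.turn_one, Fin.turn_one, Fin.add_two_add_two, h2, h, map_mul, mul_assoc]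
  have h11 : ∀ {k l : Fin 3}, (slCayley 3).dist (x * red 3 (gen (i.turn k)))
      (y * red 3 (gen ((i + 2).turn l))) ≤ 1 → k = 1 ∧ l = 1 := fun {k l} hkl => by
    -- The two families of bounds together leave only the common neighbour `a 1 = b 1` at distance
    -- at most 1.
    have key : ∀ k l : Fin 3, (![3, 2, 3] : Fin 3 → ℕ) k - (![0, 2, 0] : Fin 3 → ℕ) l ≤ 1 →
      (![3, 1, 3] : Fin 3 → ℕ) k - (![0, 1, 0] : Fin 3 → ℕ) l ≤ 1 → k = 1 ∧ l = 1 := by decide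
    exact key k l ((hle k l).trans hkl) ((hle' k l).trans hkl)
  constructor
  · have htri : triangles (slCayley 3) x y = {x * red 3 (gen (i.turn 1))} := by
      ext p
      rw [ha.mem_triangles_iff hb, Set.mem_singleton_iff]
      constructor
      · rintro ⟨k, l, rfl, hkl⟩
        rw [(h11 (k := k) (l := l) (by simp [hkl])).1]
      · rintro rfl
        exact ⟨1, 1, rfl, hsq⟩
    rw [ha.balancedForman_eq_of_not_adj hb, htri, Set.ncard_singleton]
    · norm_num
    · intro k l hkl
      obtain ⟨rfl, rfl⟩ := h11 (SimpleGraph.dist_eq_one_iff_adj.2 hkl).le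
      exact hkl.ne hsq
  · rw [ollivier_of_separates_turn le_rfl separates_three h (by norm_num) le_rfl hd]
    norm_num

theorem curvature_four {x y : Matrix.SpecialLinearGroup (Fin 2) (ZMod 4)} {i : Fin 4}
    (h : y = x * red 4 (gen i)) :
    balancedForman (slCayley 4) x y = -1 / 2 ∧ ollivier (slCayley 4) x y = -1 / 4 := by
  have hpow : ∀ i, red 4 (gen i) ^ (1 + 3) = 1 := by decide +kernel
  have hd := dist_le_of_red_pow_eq_one (by norm_num) (hpow i) h
  have ha := enumeratesOthers_turn (by norm_num) h
  have hb := enumeratesOthers_turn (by norm_num) (eq_mul_red_gen i rfl h)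
  have hle := fun k l =>
    (le_dist_of_separates (by norm_num) Fin.turn_add_two separates_four h k l).2.2
  have hpos : ∀ k l : Fin 3,
      0 < (![3, 2, 3] : Fin 3 → ℕ) k - (![0, 1, 0] : Fin 3 → ℕ) l := by decide
  have h11 : ∀ {k l : Fin 3},
      (![3, 2, 3] : Fin 3 → ℕ) k - (![0, 1, 0] : Fin 3 → ℕ) l ≤ 1 → k = 1 ∧ l = 1 := by decide
  constructor
  · rw [ha.balancedForman_eq_of_adj_iff hb 1]
    · norm_num
    · intro k l hkl
      have := hle k l
      rw [hkl, SimpleGraph.dist_self] at this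
      exact (hpos k l).not_ge this
    · intro k l
      constructor
      · intro hkl
        exact h11 ((hle k l).trans (SimpleGraph.dist_eq_one_iff_adj.2 hkl).le)
      · rintro ⟨rfl, rfl⟩
        refine SimpleGraph.dist_eq_one_iff_adj.1 (le_antisymm ?_ ((hpos 1 1).trans_le (hle 1 1)))
        rwa [Fin.turn_one, Fin.turn_one, Fin.add_two_add_two]
  · rw [ollivier_of_separates_turn (by norm_num) separates_four h (by norm_num) (by norm_num) hd]
    norm_num

theorem balancedForman_of_separates {n u : ℕ} (hn : 3 ≤ n) (hu : 2 ≤ u)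
    {x y : Matrix.SpecialLinearGroup (Fin 2) (ZMod n)} {i : Fin 4}
    (hs : Separates n Fin.turn ![3, u, 3] ![0, 0, 0]) (h : y = x * red n (gen i)) :
    balancedForman (slCayley n) x y = -1 := by
  have ha := enumeratesOthers_turn hn h
  have hb := enumeratesOthers_turn hn (eq_mul_red_gen i rfl h)
  have hle : ∀ k l, 2 ≤ (slCayley n).dist (x * red n (gen (i.turn k)))
      (y * red n (gen ((i + 2).turn l))) := fun k l => by
    refine le_trans ?_ (le_dist_of_separates (by omega) Fin.turn_add_two hs h k l).2.2
    fin_cases k <;> fin_cases l <;> simp [hu]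
  have htri : triangles (slCayley n) x y = ∅ := Set.eq_empty_of_forall_notMem fun p hp => by
    obtain ⟨k, l, -, hkl⟩ := (ha.mem_triangles_iff hb).1 hp
    have := hle k l
    simp [hkl] at this
  rw [ha.balancedForman_eq_of_not_adj hb, htri]
  · norm_num
  · intro k l hkl
    have := hle k l
    simp [SimpleGraph.dist_eq_one_iff_adj.2 hkl] at this

theorem curvature_five {x y : Matrix.SpecialLinearGroup (Fin 2) (ZMod 5)} {i : Fin 4}
    (h : y = x * red 5 (gen i)) :
    balancedForman (slCayley 5) x y = -1 ∧ ollivier (slCayley 5) x y = -3 / 8 := by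
  have hpow : ∀ i, red 5 (gen i) ^ (2 + 3) = 1 := by decide +kernel
  have hd := dist_le_of_red_pow_eq_one (by norm_num) (hpow i) h
  refine ⟨balancedForman_of_separates (by norm_num) le_rfl separates_five h, ?_⟩
  rw [ollivier_of_separates_turn (by norm_num) separates_five h (by norm_num) (by norm_num) hd]
  norm_num

theorem curvature_of_six_le {n : ℕ} [NeZero n] (hn : 6 ≤ n)
    {x y : Matrix.SpecialLinearGroup (Fin 2) (ZMod n)} {i : Fin 4} (h : y = x * red n (gen i)) :
    balancedForman (slCayley n) x y = -1 ∧ ollivier (slCayley n) x y = -1 / 2 := by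
  have hs := separates_of_six_le hn
  refine ⟨balancedForman_of_separates (by omega) (by norm_num) hs h, ?_⟩
  rw [ollivier_of_separates_turn (by omega) hs h le_rfl (by norm_num)
    (dist_le_three (by omega) h _ _)]
  norm_num

theorem mainTheorem2 (n : ℕ) [NeZero n] (hn : 2 ≤ n) :
    (∀ g : Matrix.SpecialLinearGroup (Fin 2) (ZMod n), ∀ s ∈ slGenerators n,
      (slCayley n).Adj g (g * s)) ∧
    ∀ x y : Matrix.SpecialLinearGroup (Fin 2) (ZMod n), (slCayley n).Adj x y →
      GraphCurvature.balancedForman (slCayley n) x y =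
        (if n = 2 then 0 else if n = 3 then -1 / 4 else if n = 4 then -1 / 2 else -1) ∧
      GraphCurvature.ollivier (slCayley n) x y =
        (if n = 2 then 0 else if n = 3 then -1 / 8 else if n = 4 then -1 / 4
          else if n = 5 then -3 / 8 else -1 / 2) := by
  refine ⟨fun g s hs => ?_, fun x y hxy => ?_⟩
  · obtain rfl | rfl := mem_slGenerators_iff.1 hs <;> exact (slCayley_adj_iff hn).2 ⟨_, rfl⟩
  · obtain ⟨i, h⟩ := (slCayley_adj_iff hn).1 hxy
    obtain rfl | rfl | rfl | rfl | h6 : n = 2 ∨ n = 3 ∨ n = 4 ∨ n = 5 ∨ 6 ≤ n := by omega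
    · simpa using curvature_two h
    · simpa using curvature_three h
    · simpa using curvature_four h
    · simpa using curvature_five h
    · have h2 : n ≠ 2 := by omega
      have h3 : n ≠ 3 := by omega
      have h4 : n ≠ 4 := by omega
      have h5 : n ≠ 5 := by omega
      simpa [h2, h3, h4, h5] using curvature_of_six_le h6 h
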